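/- Let $G=\mathrm{PSL}(2,\mathbb{C})\rtimes\mathbb{Z}_2$, where the nontrivial element $c$ of $\mathbb{Z}_2$ acts on $\mathrm{PSL}(2,\mathbb{C})$ by complex conjugation of matrices, $[B]\mapsto[\overline{B}]$; this is the isometry group of hyperbolic $3$-space $\mathbb{H}^3$ in the upper half-space model. Give $G$ its usual topology (the product of the quotient topology of $\mathrm{PSL}(2,\mathbb{C})$ and the discrete topology of $\mathbb{Z}_2$), and let $G_-=\{[B]_c := [B]\,c \mid B\in \mathrm{SL}(2,\mathbb{C})\}\subset G$ be the set of orientation-reversing isometries. Let $Q:G\to \mathrm{SL}(2,\mathbb{C})$ be the square map, the well-defined lift of $g\mapsto g^2$ given by $Q([B])=B^2$ and $Q([B]_c)=B\overline{B}$ for $B\in\mathrm{SL}(2,\mathbb{C})$. Then, for every $C\in \mathrm{SL}(2,\mathbb{C})$, the set $$X_2(C)=\{(A,B)\in G_-\times G_- \mid Q(A)\,Q(B)=C\},$$ with the subspace topology from $G\times G$, is non-empty and connected. -/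

import Mathlib

open scoped MatrixGroups ComplexConjugate

noncomputable section

namespace HypIsom

/-- Entrywise complex conjugation `B ↦ B̄`, as an automorphism of `SL(2, ℂ)`. -/
def conjSL : MulAut SL(2, ℂ) where
  toFun B := Matrix.SpecialLinearGroup.map (starRingEnd ℂ) B
  invFun B := Matrix.SpecialLinearGroup.map (starRingEnd ℂ) B
  left_inv B := by ext i j; simp
  right_inv B := by ext i j; simp
  map_mul' A B := map_mul _ A B

theorem conjSL_apply (B : SL(2, ℂ)) (i j : Fin 2) : conjSL B i j = conj (B i j) := rfl

theorem conjSL_mul_self : conjSL * conjSL = 1 := by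
  ext B i j; simp [MulAut.mul_apply, conjSL_apply]

/-- The group `ℤ₂`, written multiplicatively; it carries the discrete topology. -/
abbrev Z2 : Type := Multiplicative (ZMod 2)

/-- The element of `ℤ₂` different from the identity; it stands for complex conjugation `c`. -/
def c : Z2 := Multiplicative.ofAdd 1

/-- The action of `ℤ₂` on `SL(2, ℂ)` in which `c` acts by complex conjugation. -/
def actSL : Z2 →* MulAut SL(2, ℂ) where
  toFun e := if e = 1 then 1 else conjSL
  map_one' := if_pos rfl
  map_mul' a b := by
    have h : ∀ e : Z2, e = 1 ∨ e = c := by decide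
    have hc : c ≠ 1 := by decide
    have hcc : c * c = 1 := by decide
    rcases h a with rfl | rfl <;> rcases h b with rfl | rfl <;>
      simp [hc, hcc, conjSL_mul_self]

theorem actSL_c : actSL c = conjSL := by
  have hc : c ≠ 1 := by decide
  simp [actSL, hc]

theorem map_center (f : MulAut SL(2, ℂ)) :
    (Subgroup.center SL(2, ℂ)).map (f : SL(2, ℂ) →* SL(2, ℂ)) = Subgroup.center SL(2, ℂ) :=
  Subgroup.characteristic_iff_map_eq.mp inferInstance f

/-- The induced action of `ℤ₂` on `PSL(2, ℂ)`: `c` acts by `[B] ↦ [B̄]`. -/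
def actPSL : Z2 →* MulAut PSL(2, ℂ) where
  toFun e := QuotientGroup.congr _ _ (actSL e) (map_center _)
  map_one' := by ext ⟨B⟩; simp; rfl
  map_mul' a b := by ext ⟨B⟩; simp; rfl

/-- The group `G = PSL(2, ℂ) ⋊ ℤ₂` of all isometries of hyperbolic 3-space. The element
`⟨[B], 1⟩` is the Möbius transformation `[B]` and `⟨[B], c⟩` is `[B]_c`, the composition of
`[B]` with complex conjugation. -/
abbrev G : Type := PSL(2, ℂ) ⋊[actPSL] Z2

/-- `G` has the product topology of the quotient topology of `PSL(2, ℂ)` and the discrete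
topology of `ℤ₂`. -/
instance : TopologicalSpace G :=
  TopologicalSpace.induced (fun g : G => (g.left, g.right)) inferInstance

/-- The set `G₋` of the orientation-reversing isometries, i.e. of the elements `[B]_c`. -/
def Gminus : Set G := {g | g.right = c}

theorem center_mul_act (e : Z2) (Z : SL(2, ℂ)) (hZ : Z ∈ Subgroup.center SL(2, ℂ)) :
    Z * actSL e Z = 1 := by
  obtain ⟨r, hr, h⟩ := Matrix.SpecialLinearGroup.mem_center_iff.mp hZ
  have hr' : r = 1 ∨ r = -1 := by
    have h2 : r ^ 2 = 1 := by simpa using hr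
    simpa using h2
  have hZ' : Z = 1 ∨ Z = -1 := by
    rcases hr' with rfl | rfl
    · left; ext i j; simp [← h]
    · right; ext i j; fin_cases i <;> fin_cases j <;> simp [← h]
  have he : e = 1 ∨ e = c := by revert e; decide
  rcases hZ' with rfl | rfl
  · simp
  · rcases he with rfl | rfl
    · simp
    · rw [actSL_c]
      have : conjSL (-1) = -1 := by
        ext i j; fin_cases i <;> fin_cases j <;> simp [conjSL_apply]
      simp [this]

/-- The square map `Q : G → SL(2, ℂ)`, the lift of `g ↦ g²` with `Q([B]) = B²` and
`Q([B]_c) = B B̄`. -/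
def Q (g : G) : SL(2, ℂ) :=
  Quotient.liftOn' g.left (fun B => B * actSL g.right B) (by
    intro A B h
    rw [QuotientGroup.leftRel_apply] at h
    obtain ⟨Z, hZ, rfl⟩ : ∃ Z ∈ Subgroup.center SL(2, ℂ), B = A * Z := ⟨_, h, by group⟩
    have h1 := center_mul_act g.right Z hZ
    have h2 := Subgroup.mem_center_iff.mp hZ
    change A * actSL g.right A = A * Z * actSL g.right (A * Z)
    rw [map_mul, mul_assoc A Z, ← mul_assoc Z, ← h2, mul_assoc (actSL g.right A), h1, mul_one])

theorem Q_plus (B : SL(2, ℂ)) : Q ⟨(B : PSL(2, ℂ)), 1⟩ = B ^ 2 := by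
  change B * actSL 1 B = _
  rw [map_one, sq]; rfl

theorem Q_minus (B : SL(2, ℂ)) : Q ⟨(B : PSL(2, ℂ)), c⟩ = B * conjSL B := by
  change B * actSL c B = _
  rw [actSL_c]

/-- `Q` lifts the squaring map of the group `G`. -/
theorem mk_Q (g : G) : (⟨(Q g : PSL(2, ℂ)), 1⟩ : G) = g ^ 2 := by
  obtain ⟨⟨B⟩, e⟩ := g
  have he : e * e = 1 := by revert e; decide
  rw [sq]
  exact SemidirectProduct.ext rfl he.symm

/-- `X₂(C) = {(A, B) ∈ G₋ × G₋ | Q(A) Q(B) = C}`. -/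
def X₂ (C : SL(2, ℂ)) : Set (G × G) :=
  {p | p.1 ∈ Gminus ∧ p.2 ∈ Gminus ∧ Q p.1 * Q p.2 = C}

end HypIsom

end

/-! Write the two isometries as `[A]_c` and `[B]_c` and replace `B` by `W = A B̄`, a lift of their
product. Then `A Ā B B̄ = A W̄ A⁻¹ W`, so the equation becomes `A W̄ = C W⁻¹ A`: the matrix `A`
conjugates `W̄` into `C W⁻¹`. For nonscalar `W` such an `A` exists exactly when `C W⁻¹` is nonscalar
and has the same trace as `W̄`; these `W` form `productSet C`.

Over a fixed such `W`, the matrices `A` are the invertible elements of a complex vector space, hence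
a connected set, since deleting the zeros of a nonzero polynomial from a complex line does not
disconnect it. The spaces are ranges of linear maps depending continuously on `W`, so connectedness
passes from the base to the total space (`isPreconnected_pairs`) and then to its image in `G × G`.

Connectedness of `productSet C` is invariant under conjugation of `C`, which leaves the diagonal
case (`isConnected_productSet_diagonal`) and the case of a nontrivial Jordan block
(`isConnected_productSet_parabolic`). Scalar `W` occur only for `C = 1`, where a path attaches their
component to the rest (`isConnected_X₂_one`). -/

namespace HypIsom

/-! ### Intertwiners of `2 × 2` matrices -/

/-- The complex `2 × 2` matrices. -/
abbrev Mat2 : Type := Matrix (Fin 2) (Fin 2) ℂ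

/-- A matrix that is not a multiple of the identity. -/
def IsNonscalar (M : Mat2) : Prop := ∀ k : ℂ, M ≠ k • (1 : Mat2)

theorem isNonscalar_iff (M : Mat2) :
    IsNonscalar M ↔ M 0 1 ≠ 0 ∨ M 1 0 ≠ 0 ∨ M 0 0 ≠ M 1 1 := by
  constructor
  · intro h
    by_contra! h'
    apply h (M 0 0)
    ext i j; fin_cases i <;> fin_cases j <;> simp [h'.1, h'.2.1, h'.2.2]
  · rintro h k rfl
    simp at h

theorem cayleyHamilton_fin_two (M : Mat2) (h : M.det = 1) : M * M = M.trace • M - 1 := by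
  rw [Matrix.det_fin_two] at h
  ext i j; fin_cases i <;> fin_cases j <;>
    simp [Matrix.mul_apply, Matrix.trace_fin_two] <;>
    first | ring1 | linear_combination (-1) * h

theorem add_adjugate_fin_two (M : Mat2) : M + M.adjugate = M.trace • (1 : Mat2) := by
  ext i j; fin_cases i <;> fin_cases j <;>
    simp [Matrix.adjugate_fin_two, Matrix.trace_fin_two, add_comm]

/-- The linear map `T ↦ U T - T V⁻¹` onto the space of the `A` with `U A = A V`, for `U` and `V` of
determinant one and of the same trace. -/
def intertwiner (U V : Mat2) : Mat2 →ₗ[ℂ] Mat2 :=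
  LinearMap.mulLeft ℂ U - LinearMap.mulRight ℂ V.adjugate

theorem intertwiner_apply (U V T : Mat2) : intertwiner U V T = U * T - T * V.adjugate := by
  simp [intertwiner]

/-- Both sides agree by Cayley–Hamilton, `U² = tr(U) U - 1`, and `V + V⁻¹ = tr(V)`. -/
theorem intertwiner_mul {U V : Mat2} (hU : U.det = 1) (hV : V.det = 1) (h : U.trace = V.trace)
    (T : Mat2) : intertwiner U V T * V = U * intertwiner U V T := by
  have h1 : T * V.adjugate * V = T := by rw [mul_assoc, Matrix.adjugate_mul, hV]; simp
  have h2 : U * (U * T) = U.trace • (U * T) - T := by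
    rw [← mul_assoc, cayleyHamilton_fin_two U hU, sub_mul]; simp
  have h3 : U * T * V + U * (T * V.adjugate) = U.trace • (U * T) := by
    rw [← mul_assoc, ← mul_add, add_adjugate_fin_two, h]; simp
  rw [intertwiner_apply, sub_mul, mul_sub, h1, h2, ← h3]
  abel

theorem exists_commutator_eq_one {V : Mat2} (h : IsNonscalar V) :
    ∃ S : Mat2, V * S - S * V.adjugate = 1 := by
  rw [isNonscalar_iff] at h
  rcases h with h | h | h
  · refine ⟨!![0, 0; (V 0 1)⁻¹, 0], ?_⟩
    ext i j; fin_cases i <;> fin_cases j <;>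
      simp [Matrix.mul_apply, Matrix.adjugate_fin_two, h]; ring
  · refine ⟨!![0, (V 1 0)⁻¹; 0, 0], ?_⟩
    ext i j; fin_cases i <;> fin_cases j <;>
      simp [Matrix.mul_apply, Matrix.adjugate_fin_two, h]; ring
  · have h' : V 0 0 - V 1 1 ≠ 0 := sub_ne_zero.mpr h
    refine ⟨!![(V 0 0 - V 1 1)⁻¹, 0; 0, -(V 0 0 - V 1 1)⁻¹], ?_⟩
    ext i j; fin_cases i <;> fin_cases j <;>
      simp [Matrix.mul_apply, Matrix.adjugate_fin_two] <;> field_simp <;> ring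

/-- If `V S - S V⁻¹ = 1`, then `U (A S) - (A S) V⁻¹ = A (V S - S V⁻¹) = A`. Thus a fixed space of
parameters `T` reaches all solutions, whatever `U` and `V` are. -/
theorem exists_intertwiner_eq {U V A : Mat2} (h : IsNonscalar V) (hA : A * V = U * A) :
    ∃ T, intertwiner U V T = A := by
  obtain ⟨S, hS⟩ := exists_commutator_eq_one h
  refine ⟨A * S, ?_⟩
  rw [intertwiner_apply, ← mul_assoc, ← hA, mul_assoc, mul_assoc, ← mul_sub, hS, mul_one]

/-- A nonscalar matrix of determinant one is conjugate to a companion matrix. -/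
theorem exists_mul_companion {U : Mat2} (hU : U.det = 1) (h : IsNonscalar U) :
    ∃ P : Mat2, P.det ≠ 0 ∧ U * P = P * !![0, -1; 1, U.trace] := by
  rw [Matrix.det_fin_two] at hU
  -- The columns of `P` are `v = (a, b)` and `U v`; it remains to choose `v` that is not an
  -- eigenvector.
  have key : ∀ a b : ℂ, U * !![a, U 0 0 * a + U 0 1 * b; b, U 1 0 * a + U 1 1 * b] =
      !![a, U 0 0 * a + U 0 1 * b; b, U 1 0 * a + U 1 1 * b] * !![0, -1; 1, U.trace] := by
    intro a b
    ext i j; fin_cases i <;> fin_cases j <;>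
      simp [Matrix.mul_apply, Matrix.trace_fin_two]
    · linear_combination (-a) * hU
    · linear_combination (-b) * hU
  rw [isNonscalar_iff] at h
  by_cases h10 : U 1 0 = 0
  · by_cases h01 : U 0 1 = 0
    · have h' : U 1 1 - U 0 0 ≠ 0 := sub_ne_zero.mpr (by tauto)
      exact ⟨_, by simpa [Matrix.det_fin_two, h10, h01] using h', key 1 1⟩
    · exact ⟨_, by simpa [Matrix.det_fin_two] using h01, key 0 1⟩
  · exact ⟨_, by simpa [Matrix.det_fin_two] using h10, key 1 0⟩

theorem exists_det_intertwiner_ne_zero {U V : Mat2} (hU : U.det = 1) (hV : V.det = 1)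
    (h : U.trace = V.trace) (hU' : IsNonscalar U) (hV' : IsNonscalar V) :
    ∃ T, (intertwiner U V T).det ≠ 0 := by
  obtain ⟨P, hP, hPU⟩ := exists_mul_companion hU hU'
  obtain ⟨R, hR, hRV⟩ := exists_mul_companion hV hV'
  rw [← h] at hRV
  set K : Mat2 := !![0, -1; 1, U.trace]
  have hRV' : R.adjugate * V = K * R.adjugate := by
    have h1 : R.adjugate * (V * R) * R.adjugate = R.adjugate * (R * K) * R.adjugate := by rw [hRV]
    have h2 : R.adjugate * (V * R) * R.adjugate = R.det • (R.adjugate * V) := by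
      rw [mul_assoc, mul_assoc, Matrix.mul_adjugate]; simp
    have h3 : R.adjugate * (R * K) * R.adjugate = R.det • (K * R.adjugate) := by
      rw [← mul_assoc, Matrix.adjugate_mul]; simp
    rw [h2, h3] at h1
    exact smul_right_injective _ hR h1
  obtain ⟨T, hT⟩ := exists_intertwiner_eq (U := U) (A := P * R.adjugate) hV'
    (by rw [mul_assoc, hRV', ← mul_assoc, ← hPU, mul_assoc])
  refine ⟨T, ?_⟩
  rw [hT, Matrix.det_mul, Matrix.det_adjugate]
  simpa using ⟨hP, hR⟩

/-! ### Connectedness of determinant loci and of families of them -/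

theorem finite_zeros_det_line (A B : Mat2) (h : A.det ≠ 0) :
    {z : ℂ | (A + z • B).det = 0}.Finite := by
  let p : Polynomial ℂ := (Matrix.of fun i j => Polynomial.C (A i j) + Polynomial.X *
    Polynomial.C (B i j) : Matrix (Fin 2) (Fin 2) (Polynomial ℂ)).det
  have hp : ∀ z, p.eval z = (A + z • B).det := by
    intro z
    simp [p, Matrix.det_fin_two, mul_comm z]
  have hp0 : p ≠ 0 := by
    intro h0
    apply h
    simpa [h0] using (hp 0).symm
  refine (p.roots.toFinset.finite_toSet).subset fun z hz => ?_
  have : p.eval z = 0 := (hp z).trans hz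
  simpa [hp0] using this

/-- Two points are joined inside the complex line through them, where the determinant has only
finitely many zeros. -/
theorem isPreconnected_det_ne_zero (L : Mat2 →ₗ[ℂ] Mat2) :
    IsPreconnected {T : Mat2 | (L T).det ≠ 0} := by
  refine isPreconnected_of_forall_pair fun S hS T hT => ?_
  have hline : Continuous fun z : ℂ => S + z • (T - S) := by fun_prop
  have hL : ∀ z : ℂ, L (S + z • (T - S)) = L S + z • L (T - S) := by simp
  have hrank : 1 < Module.rank ℝ ℂ := by simp
  have hfin := (finite_zeros_det_line (L S) (L (T - S)) hS).countable
  refine ⟨(fun z : ℂ => S + z • (T - S)) '' {z : ℂ | (L S + z • L (T - S)).det = 0}ᶜ, ?_,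
    ⟨0, ?_, by simp⟩, ⟨1, ?_, by simp⟩,
    (hfin.isConnected_compl_of_one_lt_rank hrank).isPreconnected.image _ hline.continuousOn⟩
  · rintro _ ⟨z, hz, rfl⟩
    simpa [hL] using hz
  · simpa using hS
  · simpa using hT

/-- The pairs `(W, T)` with `W` in a connected set and `det (L W T) ≠ 0` form a connected set, for
a continuous family `L` of linear maps each of which has an invertible matrix in its range. -/
theorem isPreconnected_pairs {S : Set Mat2} (hS : IsConnected S) (L : Mat2 → Mat2 →ₗ[ℂ] Mat2)
    (hL : Continuous fun p : Mat2 × Mat2 => L p.1 p.2) (hne : ∀ W ∈ S, ∃ T, (L W T).det ≠ 0) :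
    IsConnected {p : Mat2 × Mat2 | p.1 ∈ S ∧ (L p.1 p.2).det ≠ 0} := by
  have : ConnectedSpace S := isConnected_iff_connectedSpace.mp hS
  let D : Set (S × Mat2) := {p | (L p.1 p.2).det ≠ 0}
  have hD : IsOpen D := by
    have : Continuous fun p : S × Mat2 => (L p.1 p.2).det :=
      (hL.comp (by fun_prop : Continuous fun p : S × Mat2 => ((p.1 : Mat2), p.2))).matrix_det
    exact isOpen_ne.preimage this
  let f : D → S := fun p => p.1.1
  have hf : IsOpenMap f := isOpenMap_fst.comp hD.isOpenMap_subtype_val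
  have hfc : Continuous f := by fun_prop
  have hfs : Function.Surjective f := fun W => by
    obtain ⟨T, hT⟩ := hne W W.2
    exact ⟨⟨(W, T), hT⟩, rfl⟩
  -- A quotient map with connected fibres pulls back a connected base to a connected space.
  have hq : Topology.IsQuotientMap f := hf.isQuotientMap hfc hfs
  have hfib : ∀ W : S, IsConnected (f ⁻¹' {W}) := by
    intro W
    refine ⟨hfs W, ?_⟩
    have : f ⁻¹' {W} = Subtype.val ⁻¹' ((fun T : Mat2 => (W, T)) '' {T | (L W T).det ≠ 0}) := by
      ext ⟨⟨W', T⟩, h⟩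
      simp only [f, Set.mem_preimage, Set.mem_singleton_iff, Set.mem_image, Prod.mk.injEq,
        Set.mem_ofPred_eq]
      constructor
      · rintro rfl; exact ⟨T, h, rfl, rfl⟩
      · rintro ⟨_, _, rfl, _⟩; rfl
    rw [this, ← Topology.IsInducing.subtypeVal.isPreconnected_image,
      Subtype.image_preimage_coe, Set.inter_eq_self_of_subset_right]
    · exact (isPreconnected_det_ne_zero (L W)).image _ (by fun_prop)
    · rintro _ ⟨T, hT, rfl⟩
      exact hT
  have huniv : IsConnected (Set.univ : Set D) := by
    have := hq.isCoinducing.isConnected_preimage_of_isClosed hfib isClosed_univ isConnected_univ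
    simpa using this
  have := huniv.image (fun p : D => ((p.1.1 : Mat2), p.1.2)) (by fun_prop)
  convert this using 1
  ext ⟨W, T⟩
  simp [D]

/-! ### Invertible matrices as elements of `PSL(2, ℂ)` -/

/-- The matrix `s⁻¹ M` as an element of `SL(2, ℂ)`, for a nonzero square root `s` of `det M`. -/
noncomputable def scaleToSL (s : ℂ) (M : Mat2) : SL(2, ℂ) :=
  open Classical in
  if h : s ^ 2 = M.det ∧ s ≠ 0 then
    (⟨s⁻¹ • M, by rw [Matrix.det_smul, ← h.1]; have := h.2; simp [this]⟩ : SL(2, ℂ))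
  else 1

theorem coe_scaleToSL {s : ℂ} {M : Mat2} (h : s ^ 2 = M.det) (hs : s ≠ 0) :
    (scaleToSL s M : Mat2) = s⁻¹ • M :=
  congrArg Subtype.val (dif_pos ⟨h, hs⟩ : scaleToSL s M = _)

/-- A square root of a complex number. -/
noncomputable def root (z : ℂ) : ℂ := z ^ (((2 : ℕ) : ℂ)⁻¹)

theorem root_sq (z : ℂ) : root z ^ 2 = z := Complex.cpow_nat_inv_pow z two_ne_zero

theorem root_ne_zero {z : ℂ} (h : z ≠ 0) : root z ≠ 0 := fun h0 => h (by rw [← root_sq z, h0]; simp)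

/-- The class in `PSL(2, ℂ)` of an invertible matrix. -/
noncomputable def toPSL (M : Mat2) : PSL(2, ℂ) := (scaleToSL (root M.det) M : SL(2, ℂ))

theorem mk_neg_SL (X : SL(2, ℂ)) : ((-X : SL(2, ℂ)) : PSL(2, ℂ)) = (X : PSL(2, ℂ)) := by
  rw [QuotientGroup.eq, Subgroup.mem_center_iff]
  intro g
  simp

theorem toPSL_smul (X : SL(2, ℂ)) {k : ℂ} (hk : k ≠ 0) : toPSL (k • (X : Mat2)) = X := by
  have hd : (k • (X : Mat2)).det = k ^ 2 := by
    rw [Matrix.det_smul]; simp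
  have hd0 : (k • (X : Mat2)).det ≠ 0 := by rw [hd]; exact pow_ne_zero 2 hk
  have h := coe_scaleToSL (root_sq _) (root_ne_zero hd0)
  have hs : root (k • (X : Mat2)).det = k ∨ root (k • (X : Mat2)).det = -k :=
    sq_eq_sq_iff_eq_or_eq_neg.mp ((root_sq _).trans hd)
  rw [toPSL]
  rcases hs with hs | hs
  · congr 1
    apply Subtype.ext
    rw [h, hs, smul_smul, inv_mul_cancel₀ hk, one_smul]
  · rw [← mk_neg_SL]
    congr 1
    apply Subtype.ext
    rw [Matrix.SpecialLinearGroup.coe_neg, h, hs, smul_smul, inv_neg, neg_mul,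
      inv_mul_cancel₀ hk, neg_smul, one_smul, neg_neg]

theorem toPSL_coe (X : SL(2, ℂ)) : toPSL (X : Mat2) = X := by
  simpa using toPSL_smul X one_ne_zero

theorem exists_eq_smul_SL {M : Mat2} (h : M.det ≠ 0) :
    ∃ (k : ℂ) (X : SL(2, ℂ)), k ≠ 0 ∧ M = k • (X : Mat2) := by
  refine ⟨root M.det, scaleToSL (root M.det) M, root_ne_zero h, ?_⟩
  rw [coe_scaleToSL (root_sq _) (root_ne_zero h), smul_smul, mul_inv_cancel₀ (root_ne_zero h),
    one_smul]

theorem toPSL_eq_scaleToSL {s : ℂ} {M : Mat2} (h : s ^ 2 = M.det) (hs : s ≠ 0) :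
    toPSL M = scaleToSL s M := by
  rw [← toPSL_smul (scaleToSL s M) hs, coe_scaleToSL h hs, smul_smul, mul_inv_cancel₀ hs, one_smul]

theorem continuousAt_toPSL {M₀ : Mat2} (h₀ : M₀.det ≠ 0) : ContinuousAt toPSL M₀ := by
  -- A branch of `√det` continuous near `M₀`: the principal root is only taken near `1`, away from
  -- its cut. The sign of the root does not matter in `PSL(2, ℂ)`.
  let s : Mat2 → ℂ := fun M => root M₀.det * root (M.det / M₀.det)
  have hdet : Continuous fun M : Mat2 => M.det := continuous_id.matrix_det
  have hev : ∀ᶠ M : Mat2 in nhds M₀, M.det ≠ 0 := hdet.continuousAt.eventually_ne h₀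
  have hs2 : ∀ M, s M ^ 2 = M.det := fun M => by
    simp only [s, mul_pow, root_sq]; field_simp
  have hs0 : ∀ M : Mat2, M.det ≠ 0 → s M ≠ 0 := fun M h =>
    mul_ne_zero (root_ne_zero h₀) (root_ne_zero (div_ne_zero h h₀))
  have hsc : ContinuousAt s M₀ := by
    refine continuousAt_const.mul ?_
    have h1 : ContinuousAt root (M₀.det / M₀.det) :=
      continuousAt_id.cpow continuousAt_const (by simp [h₀])
    exact ContinuousAt.comp (f := fun M : Mat2 => M.det / M₀.det) h1
      (hdet.div_const _).continuousAt
  have hSL : ContinuousAt (fun M => scaleToSL (s M) M) M₀ := by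
    have hind : Topology.IsInducing fun X : SL(2, ℂ) => (X : Mat2) := ⟨rfl⟩
    rw [hind.continuousAt_iff]
    refine ((hsc.inv₀ (hs0 _ h₀)).smul continuousAt_id).congr ?_
    filter_upwards [hev] with M hM
    exact (coe_scaleToSL (hs2 M) (hs0 M hM)).symm
  have hmk : Continuous fun X : SL(2, ℂ) => (X : PSL(2, ℂ)) := continuous_quotient_mk'
  refine (hmk.continuousAt.comp hSL).congr ?_
  filter_upwards [hev] with M hM
  exact (toPSL_eq_scaleToSL (hs2 M) (hs0 M hM)).symm

/-- The orientation-reversing isometry given by an invertible matrix. -/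
noncomputable def antiIsometry (M : Mat2) : G := ⟨toPSL M, c⟩

theorem continuousAt_antiIsometry {M : Mat2} (h : M.det ≠ 0) : ContinuousAt antiIsometry M := by
  have hind : Topology.IsInducing fun g : G => (g.left, g.right) := ⟨rfl⟩
  rw [hind.continuousAt_iff]
  exact (continuousAt_toPSL h).prodMk continuousAt_const

theorem antiIsometry_smul (X : SL(2, ℂ)) {k : ℂ} (hk : k ≠ 0) :
    antiIsometry (k • (X : Mat2)) = ⟨(X : PSL(2, ℂ)), c⟩ := by
  rw [antiIsometry, toPSL_smul X hk]

/-! ### The coordinates `(A, W)` on `X₂ C` -/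

/-- Entrywise complex conjugation of matrices. -/
def conjMat (M : Mat2) : Mat2 := M.map (starRingEnd ℂ)

theorem conjMat_apply (M : Mat2) (i j : Fin 2) : conjMat M i j = conj (M i j) := rfl

theorem coe_conjSL (X : SL(2, ℂ)) : ((conjSL X : SL(2, ℂ)) : Mat2) = conjMat X := rfl

theorem continuous_conjMat : Continuous conjMat :=
  continuous_id.matrix_map Complex.continuous_conj

theorem conjMat_smul (k : ℂ) (M : Mat2) : conjMat (k • M) = conj k • conjMat M := by
  ext i j; simp [conjMat]

theorem det_conjMat (M : Mat2) : (conjMat M).det = conj M.det := by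
  simp [conjMat_apply, Matrix.det_fin_two]

theorem conjMat_one : conjMat 1 = 1 := by simp [conjMat]

theorem conjMat_conjMat (M : Mat2) : conjMat (conjMat M) = M := by
  ext i j; simp [conjMat]

theorem conjSL_conjSL (X : SL(2, ℂ)) : conjSL (conjSL X) = X :=
  DFunLike.congr_fun conjSL_mul_self X

/-- The pair of the isometries `g = [A]_c` and `h = [B]_c` with `B = conj (A⁻¹ W)`, so that
`[W] = g h`. -/
noncomputable def pairOf (A W : Mat2) : G × G :=
  (antiIsometry A, antiIsometry (conjMat (A.adjugate * W)))

theorem continuousAt_pairOf {A W : Mat2} (hA : A.det ≠ 0) (hW : W.det ≠ 0) :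
    ContinuousAt (fun p : Mat2 × Mat2 => pairOf p.1 p.2) (A, W) := by
  have hfst : ContinuousAt (fun p : Mat2 × Mat2 => antiIsometry p.1) (A, W) :=
    ContinuousAt.comp (g := antiIsometry) (f := fun p : Mat2 × Mat2 => p.1)
      (continuousAt_antiIsometry hA) continuousAt_fst
  have hsnd : ContinuousAt
      (fun p : Mat2 × Mat2 => antiIsometry (conjMat (p.1.adjugate * p.2))) (A, W) := by
    have h1 : Continuous fun p : Mat2 × Mat2 => conjMat (p.1.adjugate * p.2) :=
      continuous_conjMat.comp (continuous_fst.matrix_adjugate.mul continuous_snd)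
    have h2 : (conjMat (A.adjugate * W)).det ≠ 0 := by
      simp [det_conjMat, Matrix.det_adjugate, hA, hW]
    exact ContinuousAt.comp (g := antiIsometry)
      (f := fun p : Mat2 × Mat2 => conjMat (p.1.adjugate * p.2)) (x := (A, W))
      (continuousAt_antiIsometry h2) h1.continuousAt
  exact hfst.prodMk hsnd

theorem pairOf_smul (A W : SL(2, ℂ)) {k : ℂ} (hk : k ≠ 0) :
    pairOf (k • (A : Mat2)) W =
      (⟨(A : PSL(2, ℂ)), c⟩, ⟨((conjSL (A⁻¹ * W) : SL(2, ℂ)) : PSL(2, ℂ)), c⟩) := by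
  rw [pairOf, antiIsometry_smul A hk]
  have : conjMat ((k • (A : Mat2)).adjugate * W) = conj k • ((conjSL (A⁻¹ * W) : SL(2, ℂ)) : Mat2) := by
    rw [coe_conjSL, Matrix.adjugate_smul, smul_mul_assoc, conjMat_smul,
      Matrix.SpecialLinearGroup.coe_mul, Matrix.SpecialLinearGroup.coe_inv]
    simp
  rw [this, antiIsometry_smul _ (by simpa using hk)]

theorem pairOf_coe (A W : SL(2, ℂ)) :
    pairOf A W = (⟨(A : PSL(2, ℂ)), c⟩, ⟨((conjSL (A⁻¹ * W) : SL(2, ℂ)) : PSL(2, ℂ)), c⟩) := by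
  simpa using pairOf_smul A W one_ne_zero

theorem pairOf_mem_iff (A W C : SL(2, ℂ)) :
    pairOf A W ∈ X₂ C ↔ A * conjSL W = C * W⁻¹ * A := by
  rw [pairOf_coe]
  simp only [X₂, Gminus, Set.mem_ofPred_eq, true_and, Q_minus, conjSL_conjSL]
  have : A * conjSL A * (conjSL (A⁻¹ * W) * (A⁻¹ * W)) = A * conjSL W * A⁻¹ * W := by
    rw [map_mul, map_inv]; group
  rw [this, ← eq_mul_inv_iff_mul_eq, mul_inv_eq_iff_eq_mul]

theorem mem_X₂_iff (C : SL(2, ℂ)) (p : G × G) :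
    p ∈ X₂ C ↔ ∃ A W : SL(2, ℂ), A * conjSL W = C * W⁻¹ * A ∧ pairOf A W = p := by
  constructor
  · rintro hp
    obtain ⟨⟨⟨A⟩, e⟩, ⟨⟨B⟩, e'⟩⟩ := p
    obtain ⟨rfl, rfl, -⟩ := id hp
    have h : pairOf A (A * conjSL B : SL(2, ℂ)) =
        (⟨(A : PSL(2, ℂ)), c⟩, ⟨(B : PSL(2, ℂ)), c⟩) := by
      rw [pairOf_coe, inv_mul_cancel_left, conjSL_conjSL]
    exact ⟨A, A * conjSL B, (pairOf_mem_iff _ _ _).mp (h ▸ hp), h⟩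
  · rintro ⟨A, W, h, rfl⟩
    exact (pairOf_mem_iff _ _ _).mpr h

/-! ### Fibring the nonscalar part of `X₂ C` over `productSet C` -/

/-- The nonscalar `W` for which `conj W` and `C W⁻¹` are conjugate and nonscalar. -/
def productSet (C : Mat2) : Set Mat2 :=
  {W | W.det = 1 ∧ conj W.trace = (C * W.adjugate).trace ∧ IsNonscalar W ∧
    IsNonscalar (C * W.adjugate)}

theorem trace_conjMat (M : Mat2) : (conjMat M).trace = conj M.trace := by
  simp [Matrix.trace_fin_two, conjMat_apply]

theorem IsNonscalar.conjMat {M : Mat2} (h : IsNonscalar M) : IsNonscalar (conjMat M) := by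
  intro k hk
  apply h (conj k)
  rw [← conjMat_conjMat M, hk, conjMat_smul, conjMat_one]

/-- The linear map `intertwiner` onto the matrices `A` with `A (conj W) = C W⁻¹ A`. -/
noncomputable def twist (C W : Mat2) : Mat2 →ₗ[ℂ] Mat2 :=
  intertwiner (C * W.adjugate) (conjMat W)

theorem isConnected_image_pairOf (C : SL(2, ℂ)) (h : IsConnected (productSet C)) :
    IsConnected ((fun p : Mat2 × Mat2 => pairOf (twist C p.1 p.2) p.1) ''
      {p : Mat2 × Mat2 | p.1 ∈ productSet C ∧ (twist C p.1 p.2).det ≠ 0}) := by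
  have hc : Continuous fun p : Mat2 × Mat2 => twist C p.1 p.2 := by
    simp only [twist, intertwiner_apply]
    have h1 : Continuous fun p : Mat2 × Mat2 => p.1.adjugate := continuous_fst.matrix_adjugate
    have h2 : Continuous fun p : Mat2 × Mat2 => (conjMat p.1).adjugate :=
      (continuous_conjMat.comp continuous_fst).matrix_adjugate
    fun_prop
  refine (isPreconnected_pairs h (twist C) hc ?_).image _ ?_
  · rintro W ⟨hW, htr, h1, h2⟩
    exact exists_det_intertwiner_ne_zero (by simp [hW, Matrix.det_adjugate])
      (by simp [det_conjMat, hW]) (by rw [trace_conjMat, htr]) h2 h1.conjMat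
  · rintro p ⟨hp, hdet⟩
    refine ContinuousAt.continuousWithinAt ?_
    exact ContinuousAt.comp (f := fun p : Mat2 × Mat2 => (twist C p.1 p.2, p.1))
      (continuousAt_pairOf hdet (by rw [hp.1]; exact one_ne_zero))
      (hc.prodMk continuous_fst).continuousAt

theorem image_pairOf_subset (C : SL(2, ℂ)) :
    (fun p : Mat2 × Mat2 => pairOf (twist C p.1 p.2) p.1) ''
      {p : Mat2 × Mat2 | p.1 ∈ productSet C ∧ (twist C p.1 p.2).det ≠ 0} ⊆ X₂ C := by
  rintro _ ⟨⟨W, T⟩, ⟨⟨hW, htr, h1, h2⟩, hdet⟩, rfl⟩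
  dsimp only at *
  obtain ⟨W, rfl⟩ : ∃ X : SL(2, ℂ), (X : Mat2) = W := ⟨⟨W, hW⟩, rfl⟩
  have hmul : twist C W T * conjMat W = (C * (W : Mat2).adjugate) * twist C W T :=
    intertwiner_mul (by simp [Matrix.det_adjugate])
      (by simp [det_conjMat]) (by rw [trace_conjMat, htr]) T
  obtain ⟨k, A, hk, hA⟩ := exists_eq_smul_SL hdet
  rw [hA] at hmul
  rw [hA, pairOf_smul A W hk, ← pairOf_coe, pairOf_mem_iff]
  apply Subtype.ext
  rw [smul_mul_assoc, mul_smul_comm] at hmul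
  simpa [coe_conjSL] using smul_right_injective _ hk hmul

/-- Since `C W⁻¹ = A W̄ A⁻¹`, it inherits its trace and nonscalarity from `W̄`. -/
theorem pairOf_mem_image (C A W : SL(2, ℂ)) (h : A * conjSL W = C * W⁻¹ * A)
    (hW : IsNonscalar W) :
    pairOf A W ∈ (fun p : Mat2 × Mat2 => pairOf (twist C p.1 p.2) p.1) ''
      {p : Mat2 × Mat2 | p.1 ∈ productSet C ∧ (twist C p.1 p.2).det ≠ 0} := by
  have h' : (A : Mat2) * conjMat W = (C * (W : Mat2).adjugate) * A := by
    simpa [coe_conjSL] using congrArg (Subtype.val : SL(2, ℂ) → Mat2) h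
  have h'' : (C * (W : Mat2).adjugate : Mat2) = A * conjMat W * (A : Mat2).adjugate := by
    rw [h', mul_assoc, Matrix.mul_adjugate]; simp
  obtain ⟨T, hT⟩ := exists_intertwiner_eq hW.conjMat h'
  refine ⟨(W, T), ⟨⟨W.2, ?_, hW, ?_⟩, ?_⟩, ?_⟩
  · dsimp only
    rw [h'', mul_assoc, Matrix.trace_mul_comm, mul_assoc, Matrix.adjugate_mul]
    simp [trace_conjMat]
  · intro k hk
    dsimp only at hk
    rw [hk] at h'
    apply hW.conjMat k
    have h3 := congrArg (fun M => (A : Mat2).adjugate * M) h'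
    simpa [← mul_assoc, Matrix.adjugate_mul] using h3
  · simp only [twist]; rw [hT]; simp
  · simp only [twist]; rw [hT]

/-- `X₂ C` is connected for `C ≠ 1`, once `productSet C` is. -/
theorem isConnected_X₂_of_ne_one {C : SL(2, ℂ)} (hC : C ≠ 1) (h : IsConnected (productSet C)) :
    IsConnected (X₂ C) := by
  convert isConnected_image_pairOf C h using 1
  refine Set.Subset.antisymm ?_ (image_pairOf_subset C)
  intro p hp
  obtain ⟨A, W, hAW, rfl⟩ := (mem_X₂_iff C p).mp hp
  -- A scalar `W` is `±1`, and then `A W̄ = C W⁻¹ A` reduces to `A = C A`.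
  refine pairOf_mem_image C A W hAW ?_
  intro k hk
  apply hC
  have hk2 : k ^ 2 = 1 := by
    have := W.2
    rw [hk] at this
    simpa using this
  have hW : W = 1 ∨ W = -1 := by
    rcases sq_eq_sq_iff_eq_or_eq_neg.mp (hk2.trans (one_pow 2).symm) with rfl | rfl
    · left; apply Subtype.ext; simpa using hk
    · right; apply Subtype.ext; simpa using hk
  have hneg : conjSL (-1) = -1 := by
    apply Subtype.ext
    rw [coe_conjSL]
    ext i j; simp [conjMat_apply, Matrix.one_apply, apply_ite conj]
  rcases hW with rfl | rfl
  · simpa using hAW.symm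
  · rw [hneg] at hAW
    simpa using hAW.symm

/-! ### Connectedness of `productSet C` -/

theorem conj_mem_productSet {C W : Mat2} (g : SL(2, ℂ)) (hW : W ∈ productSet C) :
    (g : Mat2) * W * (g : Mat2).adjugate ∈ productSet (g * C * (g : Mat2).adjugate) := by
  have h1 : (g : Mat2).adjugate * g = 1 := by simp [Matrix.adjugate_mul]
  have h2 : (g : Mat2) * (g : Mat2).adjugate = 1 := by simp [Matrix.mul_adjugate]
  have htr : ∀ M : Mat2, ((g : Mat2) * M * (g : Mat2).adjugate).trace = M.trace := fun M => by
    rw [Matrix.trace_mul_comm, ← mul_assoc, h1, one_mul]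
  have hns : ∀ M : Mat2, IsNonscalar M → IsNonscalar ((g : Mat2) * M * (g : Mat2).adjugate) := by
    intro M hM k hk
    apply hM k
    have h3 : (g : Mat2).adjugate * (g * M * (g : Mat2).adjugate) * g = M := by
      calc _ = ((g : Mat2).adjugate * g) * M * ((g : Mat2).adjugate * g) := by
            simp only [mul_assoc]
        _ = M := by rw [h1, one_mul, mul_one]
    rw [← h3, hk]
    simp [h1]
  have hadj : (g * C * (g : Mat2).adjugate) * (g * W * (g : Mat2).adjugate).adjugate =
      g * (C * W.adjugate) * (g : Mat2).adjugate := by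
    have h4 : (g : Mat2).adjugate.adjugate = g := by
      rw [Matrix.adjugate_adjugate']; simp
    rw [Matrix.adjugate_mul_distrib, Matrix.adjugate_mul_distrib, h4]
    calc _ = (g : Mat2) * C * ((g : Mat2).adjugate * g) * (W.adjugate * (g : Mat2).adjugate) := by
          simp only [mul_assoc]
      _ = _ := by rw [h1]; simp only [mul_one, mul_assoc]
  obtain ⟨hd, ht, hn, hn'⟩ := hW
  refine ⟨by simp [hd, Matrix.det_adjugate], ?_, hns _ hn, ?_⟩
  · rw [hadj, htr, htr, ht]
  · rw [hadj]; exact hns _ hn'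

theorem isConnected_productSet_of_conj {C : SL(2, ℂ)} (g : SL(2, ℂ))
    (h : IsConnected (productSet (g * C * g⁻¹ : SL(2, ℂ)))) : IsConnected (productSet C) := by
  convert h.image (fun W : Mat2 => (g⁻¹ : SL(2, ℂ)).1 * W * g) (by fun_prop) using 1
  ext W
  constructor
  · intro hW
    refine ⟨g * W * (g : Mat2).adjugate, by simpa using conj_mem_productSet g hW, ?_⟩
    dsimp only
    have h1 : (g : Mat2).adjugate * g = 1 := by simp [Matrix.adjugate_mul]
    rw [Matrix.SpecialLinearGroup.coe_inv]
    calc _ = ((g : Mat2).adjugate * g) * W * ((g : Mat2).adjugate * g) := by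
          simp only [mul_assoc]
      _ = W := by rw [h1, one_mul, mul_one]
  · rintro ⟨W, hW, rfl⟩
    have h2 := conj_mem_productSet g⁻¹ hW
    have h3 : ((g⁻¹ : SL(2, ℂ)) : Mat2).adjugate = g := by
      rw [← Matrix.SpecialLinearGroup.coe_inv, inv_inv]
    have h4 : ((g⁻¹ : SL(2, ℂ)) : Mat2) * ((g * C * g⁻¹ : SL(2, ℂ)) : Mat2) * g = C := by
      rw [← Matrix.SpecialLinearGroup.coe_mul, ← Matrix.SpecialLinearGroup.coe_mul]
      exact congrArg Subtype.val (by group : g⁻¹ * (g * C * g⁻¹) * g = C)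
    rw [h3, h4] at h2
    exact h2

theorem mem_productSet_upper_iff (p q s x y z w : ℂ) :
    !![x, y; z, w] ∈ productSet !![p, q; 0, s] ↔
      x * w - y * z = 1 ∧ conj (x + w) = p * w - q * z + s * x ∧ (y ≠ 0 ∨ z ≠ 0 ∨ x ≠ w) ∧
      (q * x - p * y ≠ 0 ∨ s * z ≠ 0 ∨ p * w - q * z ≠ s * x) := by
  have h1 : !![p, q; 0, s] * (!![x, y; z, w] : Mat2).adjugate =
      !![p * w - q * z, q * x - p * y; -(s * z), s * x] := by
    ext i j; fin_cases i <;> fin_cases j <;>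
      simp [Matrix.adjugate_fin_two, Matrix.mul_apply] <;> ring
  rw [productSet, Set.mem_ofPred_eq, h1, isNonscalar_iff, isNonscalar_iff]
  simp [Matrix.det_fin_two, Matrix.trace_fin_two]

theorem continuousOn_matrix_of {X : Type*} [TopologicalSpace X] {s : Set X} {a b c d : X → ℂ}
    (ha : ContinuousOn a s) (hb : ContinuousOn b s) (hc : ContinuousOn c s)
    (hd : ContinuousOn d s) :
    ContinuousOn (fun t => (!![a t, b t; c t, d t] : Mat2)) s := by
  refine continuousOn_pi.mpr fun i => continuousOn_pi.mpr fun j => ?_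
  fin_cases i <;> fin_cases j <;> simpa

theorem continuous_matrix_of {X : Type*} [TopologicalSpace X] {a b c d : X → ℂ}
    (ha : Continuous a) (hb : Continuous b) (hc : Continuous c) (hd : Continuous d) :
    Continuous (fun t => (!![a t, b t; c t, d t] : Mat2)) := by
  rw [← continuousOn_univ] at *
  exact continuousOn_matrix_of ha hb hc hd

theorem isPreconnected_punctured : IsPreconnected ({0}ᶜ : Set ℂ) :=
  (isConnected_compl_singleton_of_one_lt_rank (by simp) 0).isPreconnected

/-- The trace condition is real-linear and involves only the diagonal entries `x, w`, while `y z = x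
w - 1`. The charts `y ≠ 0` and `z ≠ 0` are therefore images of a real vector space times a punctured
plane. They share a point, and the remaining diagonal matrices are limits of points with `z = 0`, `y
≠ 0`. -/
theorem isConnected_productSet_diagonal {l m : ℂ} (hl : l ≠ 0) (hm : m ≠ 0) :
    IsConnected (productSet !![l, 0; 0, m]) := by
  let P : Set (ℂ × ℂ) := {p | conj (p.1 + p.2) = l * p.2 + m * p.1}
  have hP : IsPreconnected P := by
    refine Convex.isPreconnected ?_
    intro p hp q hq a b _ _ _
    simp only [P, Set.mem_ofPred_eq, map_add] at hp hq
    simp only [P, Set.mem_ofPred_eq, Prod.fst_add, Prod.snd_add, Prod.smul_fst, Prod.smul_snd,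
      Complex.real_smul, map_add, map_mul, Complex.conj_ofReal]
    linear_combination (a : ℂ) * hp + (b : ℂ) * hq
  have hPy : IsPreconnected (P ×ˢ ({0}ᶜ : Set ℂ)) := hP.prod isPreconnected_punctured
  let f : (ℂ × ℂ) × ℂ → Mat2 := fun t =>
    !![t.1.1, t.2; (t.1.1 * t.1.2 - 1) / t.2, t.1.2]
  let f' : (ℂ × ℂ) × ℂ → Mat2 := fun t =>
    !![t.1.1, (t.1.1 * t.1.2 - 1) / t.2; t.2, t.1.2]
  have hdiv : ContinuousOn (fun t : (ℂ × ℂ) × ℂ => (t.1.1 * t.1.2 - 1) / t.2)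
      (P ×ˢ ({0}ᶜ : Set ℂ)) :=
    ContinuousOn.div (by fun_prop) (by fun_prop) fun t ht => ht.2
  have hf : IsPreconnected (f '' (P ×ˢ ({0}ᶜ : Set ℂ))) :=
    hPy.image f (continuousOn_matrix_of (by fun_prop) (by fun_prop) hdiv (by fun_prop))
  have hf' : IsPreconnected (f' '' (P ×ˢ ({0}ᶜ : Set ℂ))) :=
    hPy.image f' (continuousOn_matrix_of (by fun_prop) hdiv (by fun_prop) (by fun_prop))
  have h0 : (0, 0) ∈ P := by simp [P]
  have hi : !![0, 1; -1, 0] ∈ f '' (P ×ˢ ({0}ᶜ : Set ℂ)) := ⟨((0, 0), 1), ⟨h0, by simp⟩, by simp [f]⟩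
  have hi' : !![0, 1; -1, 0] ∈ f' '' (P ×ˢ ({0}ᶜ : Set ℂ)) :=
    ⟨((0, 0), -1), ⟨h0, by simp⟩, by simp [f']⟩
  have hu := IsPreconnected.union _ hi hi' hf hf'
  refine IsConnected.subset_closure ⟨⟨_, Or.inl hi⟩, hu⟩ ?_ ?_
  · rintro _ (⟨⟨⟨x, w⟩, y⟩, ⟨hp, hy⟩, rfl⟩ | ⟨⟨⟨x, w⟩, z⟩, ⟨hp, hz⟩, rfl⟩)
    · have hy' : y ≠ 0 := hy
      rw [mem_productSet_upper_iff]
      refine ⟨by rw [mul_div_cancel₀ _ hy']; ring, ?_, Or.inl hy', Or.inl ?_⟩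
      · rw [zero_mul, sub_zero]; exact hp
      · simpa using ⟨hl, hy'⟩
    · have hz' : z ≠ 0 := hz
      rw [mem_productSet_upper_iff]
      refine ⟨by rw [div_mul_cancel₀ _ hz']; ring, ?_, Or.inr (Or.inl hz'),
        Or.inr (Or.inl (mul_ne_zero hm hz'))⟩
      rw [zero_mul, sub_zero]; exact hp
  · intro W hW
    rw [Matrix.eta_fin_two W, mem_productSet_upper_iff] at hW
    obtain ⟨hd, ht, -, -⟩ := hW
    have hp : (W 0 0, W 1 1) ∈ P := by simpa [P] using ht
    rw [Matrix.eta_fin_two W]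
    by_cases h01 : W 0 1 = 0
    · by_cases h10 : W 1 0 = 0
      · have hd' : W 0 0 * W 1 1 = 1 := by simpa [h01] using hd
        have hcl : (0 : ℂ) ∈ closure ({0}ᶜ : Set ℂ) := by
          rw [(dense_compl_singleton (0 : ℂ)).closure_eq]; trivial
        have hc : Continuous fun y : ℂ => (!![W 0 0, y; 0, W 1 1] : Mat2) :=
          continuous_matrix_of (by fun_prop) (by fun_prop) (by fun_prop) (by fun_prop)
        rw [h01, h10]
        refine map_mem_closure (f := fun y : ℂ => (!![W 0 0, y; 0, W 1 1] : Mat2))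
          hc hcl fun y hy => Or.inl ⟨((W 0 0, W 1 1), y), ⟨hp, hy⟩, ?_⟩
        simp [f, hd']
      · refine subset_closure (Or.inr ⟨((W 0 0, W 1 1), W 1 0), ⟨hp, h10⟩, ?_⟩)
        simp only [f']
        congr 4
        rw [div_eq_iff h10]; linear_combination hd
    · refine subset_closure (Or.inl ⟨((W 0 0, W 1 1), W 0 1), ⟨hp, h01⟩, ?_⟩)
      simp only [f]
      congr 4
      rw [div_eq_iff h01]; linear_combination hd

/-- The triangular case. The number `σ` spans the values of `s - e (conj s)`, for `e = 1` or
`e = -1`. -/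
theorem isConnected_productSet_parabolic {e b σ : ℂ} (he : e ^ 2 = 1) (hb : b ≠ 0) (hσ : σ ≠ 0)
    (h : ∀ s : ℂ, s - e * conj s = 2 * σ * ((s / σ).re : ℂ)) :
    IsConnected (productSet !![e, e * b; 0, e]) := by
  have he0 : e ≠ 0 := by rintro rfl; simp at he
  have htr : ∀ x z w : ℂ, conj (x + w) = e * w - e * b * z + e * x ↔
      z = 2 * σ * (((x + w) / σ).re : ℂ) / b := by
    intro x z w
    rw [eq_div_iff hb, ← h]
    constructor
    · intro h'; rw [h']; linear_combination (x + w - b * z) * he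
    · intro h'
      linear_combination e * h' - conj (x + w) * he
  -- The trace condition now determines the lower left entry as `2 σ r / b`. Where it is nonzero the
  -- determinant gives the upper right entry, so this part is a graph over the two open half-spaces
  -- `r > 0` and `r < 0`.
  let r : ℂ × ℂ → ℝ := fun p => ((p.1 + p.2) / σ).re
  let H : ℝ → Set (ℂ × ℂ) := fun τ => {p | 0 < τ * r p}
  let f : ℂ × ℂ → Mat2 := fun p =>
    !![p.1, (p.1 * p.2 - 1) / (2 * σ * (r p : ℂ) / b); 2 * σ * (r p : ℂ) / b, p.2]
  have hr : Continuous r := by fun_prop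
  have hr0 : ∀ τ, ∀ p ∈ H τ, r p ≠ 0 := by
    intro τ p hp h0
    have : 0 < τ * r p := hp
    simp [h0] at this
  have hrz : ∀ τ, ∀ p ∈ H τ, 2 * σ * (r p : ℂ) / b ≠ 0 := fun τ p hp => by
    have := hr0 τ p hp
    simp [this, hσ, hb]
  have hH : ∀ τ, IsPreconnected (f '' H τ) := by
    intro τ
    refine IsPreconnected.image (Convex.isPreconnected ?_) f ?_
    · intro p hp q hq u v hu hv huv
      have hlin : r (u • p + v • q) = u * r p + v * r q := by
        have : (u • p + v • q).1 + (u • p + v • q).2 = u * (p.1 + p.2) + v * (q.1 + q.2) := by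
          simp; ring
        simp only [r]
        rw [this, add_div, mul_div_assoc, mul_div_assoc, Complex.add_re, Complex.re_ofReal_mul,
          Complex.re_ofReal_mul]
      have h1 : 0 < τ * r p := hp
      have h2 : 0 < τ * r q := hq
      change 0 < τ * r (u • p + v • q)
      rw [hlin]
      have h3 := convex_Ioi (0 : ℝ) h1 h2 hu hv huv
      simp only [smul_eq_mul, Set.mem_Ioi] at h3
      linarith
    · have hz : Continuous fun p => 2 * σ * (r p : ℂ) / b := by fun_prop
      exact continuousOn_matrix_of (by fun_prop)
        (ContinuousOn.div (by fun_prop) hz.continuousOn (hrz τ)) hz.continuousOn (by fun_prop)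
  -- Points on the wall `r = 0` with distinct diagonal entries are approached from both sides.
  have hK : ∀ τ : ℝ, τ ≠ 0 → ∀ x y w : ℂ, x * w = 1 → x ≠ w → r (x, w) = 0 →
      !![x, y; 0, w] ∈ closure (f '' H τ) := by
    intro τ hτ x y w hxw hne hrx
    have hne' : w - x ≠ 0 := sub_ne_zero.mpr hne.symm
    -- Moving the diagonal in the direction `(a, σ - a)` makes `r` grow at unit rate. This `a`
    -- cancels the first-order term of the determinant; the correction of `y` in `g` cancels the
    -- second-order term.
    let a : ℂ := (y * (2 * σ / b) - σ * x) / (w - x)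
    have ha : a * w + (σ - a) * x = y * (2 * σ / b) := by
      have : a * (w - x) = y * (2 * σ / b) - σ * x := div_mul_cancel₀ _ hne'
      linear_combination this
    let g : ℝ → Mat2 := fun δ => !![x + (τ * δ : ℝ) * a,
      y + (τ * δ : ℝ) * (a * (σ - a)) * (b / (2 * σ)); (τ * δ : ℝ) * (2 * σ / b),
      w + (τ * δ : ℝ) * (σ - a)]
    have hg : Continuous g :=
      continuous_matrix_of (by fun_prop) (by fun_prop) (by fun_prop) (by fun_prop)
    have hg0 : g 0 = !![x, y; 0, w] := by simp [g]
    have hcl : (0 : ℝ) ∈ closure (Set.Ioi (0 : ℝ)) := by simp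
    rw [← hg0]
    refine map_mem_closure hg hcl fun δ hδ => ?_
    have hrδ : r (x + (τ * δ : ℝ) * a, w + (τ * δ : ℝ) * (σ - a)) = τ * δ := by
      have h1 : x + (τ * δ : ℝ) * a + (w + (τ * δ : ℝ) * (σ - a)) = x + w + (τ * δ : ℝ) * σ := by
        ring
      simp only [r] at hrx ⊢
      rw [h1, add_div, Complex.add_re, hrx, mul_div_assoc, div_self hσ, mul_one, zero_add,
        Complex.ofReal_re]
    have hδ0 : τ * δ ≠ 0 := mul_ne_zero hτ (ne_of_gt hδ)
    have hδ0' : ((τ * δ : ℝ) : ℂ) ≠ 0 := by exact_mod_cast hδ0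
    refine ⟨(x + (τ * δ : ℝ) * a, w + (τ * δ : ℝ) * (σ - a)), ?_, ?_⟩
    · change 0 < τ * r _
      rw [hrδ, ← mul_assoc]
      exact mul_pos (mul_self_pos.mpr hτ) hδ
    · simp only [f, hrδ, g]
      generalize ((τ * δ : ℝ) : ℂ) = d at *
      congr 3
      · congr 2
        field_simp
        field_simp at ha
        linear_combination b * hxw + d * ha
      · congr 1
        ring
  have hmem : ∀ τ, f '' H τ ⊆ productSet !![e, e * b; 0, e] := by
    rintro τ _ ⟨⟨x, w⟩, hp, rfl⟩
    have hz := hrz τ _ hp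
    rw [mem_productSet_upper_iff]
    refine ⟨by rw [div_mul_cancel₀ _ hz]; ring, (htr _ _ _).mpr rfl, Or.inr (Or.inl hz),
      Or.inr (Or.inl (mul_ne_zero he0 hz))⟩
  -- A point of trace zero, hence on the wall, which joins the two halves.
  let k : Mat2 := !![Complex.I, 0; 0, -Complex.I]
  have hII : Complex.I ≠ -Complex.I := fun h0 => Complex.I_ne_zero (self_eq_neg.mp h0)
  have hk : k ∈ productSet !![e, e * b; 0, e] := by
    rw [mem_productSet_upper_iff]
    refine ⟨by simp, by simp, Or.inr (Or.inr hII), Or.inr (Or.inr ?_)⟩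
    intro h0
    exact hII.symm (mul_left_cancel₀ he0 (by simpa using h0))
  have hkcl : ∀ τ : ℝ, τ ≠ 0 → IsPreconnected (insert k (f '' H τ)) := fun τ hτ =>
    (hH τ).subset_closure (Set.subset_insert _ _) (Set.insert_subset
      (hK τ hτ _ _ _ (by simp) hII (by simp [r])) subset_closure)
  have hu := IsPreconnected.union k (Set.mem_insert _ _) (Set.mem_insert _ _)
    (hkcl 1 one_ne_zero) (hkcl (-1) (by norm_num))
  refine IsConnected.subset_closure ⟨⟨k, Or.inl (Set.mem_insert _ _)⟩, hu⟩ ?_ ?_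
  · exact Set.union_subset (Set.insert_subset hk (hmem 1)) (Set.insert_subset hk (hmem (-1)))
  · intro W hW
    rw [Matrix.eta_fin_two W, mem_productSet_upper_iff, htr] at hW
    obtain ⟨hd, hz, -, -⟩ := hW
    change W 1 0 = 2 * σ * (r (W 0 0, W 1 1) : ℂ) / b at hz
    rw [Matrix.eta_fin_two W]
    by_cases h0 : r (W 0 0, W 1 1) = 0
    · have h10 : W 1 0 = 0 := by rw [hz, h0]; simp
      rw [h10] at hd ⊢
      have hd' : W 0 0 * W 1 1 = 1 := by simpa using hd
      have hsub : closure (f '' H 1) ⊆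
          closure (insert k (f '' H 1) ∪ insert k (f '' H (-1))) :=
        closure_mono ((Set.subset_insert _ _).trans Set.subset_union_left)
      apply hsub
      by_cases hxw : W 0 0 = W 1 1
      -- Equal diagonal entries on the wall: scaling them by `exp u` and `exp (-u)` keeps `x w = 1`
      -- and `r = 0` but separates them for `u > 0`, so `hK` applies and `u → 0` gives the limit.
      · let g : ℝ → Mat2 := fun u =>
          !![(Real.exp u : ℝ) * W 0 0, W 0 1; 0, (Real.exp (-u) : ℝ) * W 1 1]
        have hg : Continuous g :=
          continuous_matrix_of (by fun_prop) (by fun_prop) (by fun_prop) (by fun_prop)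
        have hg0 : g 0 = !![W 0 0, W 0 1; 0, W 1 1] := by simp [g]
        have hcl : (0 : ℝ) ∈ closure (Set.Ioi (0 : ℝ)) := by simp
        have hexp : ∀ u : ℝ, ((Real.exp u : ℝ) : ℂ) * (Real.exp (-u) : ℝ) = 1 := fun u => by
          rw [← Complex.ofReal_mul, ← Real.exp_add]; simp
        rw [← hg0, ← isClosed_closure.closure_eq]
        refine map_mem_closure hg hcl fun u hu => hK 1 one_ne_zero _ _ _ ?_ ?_ ?_
        · linear_combination ((Real.exp u : ℝ) : ℂ) * (Real.exp (-u) : ℝ) * hd' + hexp u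
        · rw [← hxw]
          have hx0 : W 0 0 ≠ 0 := left_ne_zero_of_mul_eq_one hd'
          intro h1
          have h2 := mul_right_cancel₀ hx0 h1
          have h3 : Real.exp u = Real.exp (-u) := by exact_mod_cast h2
          have h4 := Real.exp_injective h3
          have h5 : (0 : ℝ) < u := hu
          linarith
        · simp only [r] at h0 ⊢
          rw [← hxw] at h0 ⊢
          rw [← two_mul, mul_div_assoc, Complex.mul_re] at h0
          rw [← add_mul, ← Complex.ofReal_add, mul_div_assoc, Complex.re_ofReal_mul]
          simp at h0
          simp [h0]
      · exact hK 1 one_ne_zero _ _ _ hd' hxw h0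
    · have hz0 : W 1 0 ≠ 0 := by
        rw [hz]
        simp [h0, hσ, hb]
      have hfW : f (W 0 0, W 1 1) = !![W 0 0, W 0 1; W 1 0, W 1 1] := by
        simp only [f, ← hz]
        congr 4
        rw [div_eq_iff hz0]; linear_combination hd
      apply subset_closure
      rw [← hfW]
      rcases lt_or_gt_of_ne h0 with h1 | h1
      · refine Or.inr (Set.mem_insert_of_mem _ ⟨_, ?_, rfl⟩)
        change 0 < -1 * r _
        linarith
      · refine Or.inl (Set.mem_insert_of_mem _ ⟨_, ?_, rfl⟩)
        change 0 < 1 * r _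
        linarith

theorem exists_conj_lower_left_eq_zero (C : SL(2, ℂ)) :
    ∃ g : SL(2, ℂ), (g * C * g⁻¹ : SL(2, ℂ)) 1 0 = 0 := by
  by_cases h : C 1 0 = 0
  · exact ⟨1, by simpa using h⟩
  -- The quadratic says that `(t, 1)`, the first column of `g⁻¹` below, is an eigenvector of `C`.
  · obtain ⟨t, ht⟩ : ∃ t : ℂ, C 1 0 * (t * t) + (C 1 1 - C 0 0) * t + -C 0 1 = 0 := by
      obtain ⟨s, hs⟩ := IsAlgClosed.exists_eq_mul_self (discrim (C 1 0) (C 1 1 - C 0 0) (-C 0 1))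
      exact exists_quadratic_eq_zero h ⟨s, hs⟩
    obtain ⟨g, hg⟩ : ∃ g : SL(2, ℂ), (g : Mat2) = !![0, 1; -1, t] :=
      ⟨⟨!![0, 1; -1, t], by simp [Matrix.det_fin_two]⟩, rfl⟩
    refine ⟨g, ?_⟩
    rw [Matrix.SpecialLinearGroup.coe_mul, Matrix.SpecialLinearGroup.coe_mul,
      Matrix.SpecialLinearGroup.coe_inv, hg]
    simp [Matrix.mul_apply, Matrix.adjugate_fin_two, Matrix.vecMul, dotProduct]
    linear_combination ht

theorem isConnected_productSet_upper {l q m : ℂ} (hlm : l * m = 1) :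
    IsConnected (productSet !![l, q; 0, m]) := by
  have hl : l ≠ 0 := left_ne_zero_of_mul_eq_one hlm
  have hm : m ≠ 0 := right_ne_zero_of_mul_eq_one hlm
  by_cases hq : q = 0
  · rw [hq]; exact isConnected_productSet_diagonal hl hm
  by_cases h : l = m
  · subst h
    have he : l ^ 2 = 1 := by rw [sq, hlm]
    have hq' : q = l * (l * q) := by rw [← mul_assoc, hlm, one_mul]
    rw [hq']
    have hb : l * q ≠ 0 := mul_ne_zero hl hq
    rcases sq_eq_sq_iff_eq_or_eq_neg.mp (he.trans (one_pow 2).symm) with rfl | rfl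
    · refine isConnected_productSet_parabolic he hb Complex.I_ne_zero fun s => ?_
      apply Complex.ext <;> simp [Complex.div_I]; ring
    · refine isConnected_productSet_parabolic he hb one_ne_zero fun s => ?_
      apply Complex.ext <;> simp; ring
  · have h' : l - m ≠ 0 := sub_ne_zero.mpr h
    obtain ⟨C, hC⟩ : ∃ C : SL(2, ℂ), (C : Mat2) = !![l, q; 0, m] :=
      ⟨⟨!![l, q; 0, m], by simpa [Matrix.det_fin_two] using hlm⟩, rfl⟩
    obtain ⟨g, hg⟩ : ∃ g : SL(2, ℂ), (g : Mat2) = !![1, q / (l - m); 0, 1] :=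
      ⟨⟨!![1, q / (l - m); 0, 1], by simp [Matrix.det_fin_two]⟩, rfl⟩
    have hgC : ((g * C * g⁻¹ : SL(2, ℂ)) : Mat2) = !![l, 0; 0, m] := by
      rw [Matrix.SpecialLinearGroup.coe_mul, Matrix.SpecialLinearGroup.coe_mul,
        Matrix.SpecialLinearGroup.coe_inv, hg, hC]
      ext i j; fin_cases i <;> fin_cases j <;>
        simp [Matrix.mul_apply, Matrix.adjugate_fin_two]
      field_simp
      ring
    rw [← hC]
    refine isConnected_productSet_of_conj g ?_
    rw [hgC]
    exact isConnected_productSet_diagonal hl hm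

theorem isConnected_productSet (C : SL(2, ℂ)) : IsConnected (productSet C) := by
  obtain ⟨g, hg⟩ := exists_conj_lower_left_eq_zero C
  refine isConnected_productSet_of_conj g ?_
  have hd := (g * C * g⁻¹).2
  rw [Matrix.eta_fin_two (g * C * g⁻¹ : SL(2, ℂ)).1, hg]
  rw [Matrix.det_fin_two, hg] at hd
  exact isConnected_productSet_upper (by simpa using hd)

/-! ### The exceptional case `C = 1` and the conclusion -/

theorem isConnected_X₂_one : IsConnected (X₂ 1) := by
  have h1 := isConnected_image_pairOf 1 (isConnected_productSet 1)
  have hsub := image_pairOf_subset 1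
  set E := (fun p : Mat2 × Mat2 => pairOf (twist ((1 : SL(2, ℂ)) : Mat2) p.1 p.2) p.1) ''
      {p : Mat2 × Mat2 | p.1 ∈ productSet ((1 : SL(2, ℂ)) : Mat2) ∧
        (twist ((1 : SL(2, ℂ)) : Mat2) p.1 p.2).det ≠ 0}
  -- The scalar part: for `W = 1` every invertible `A` is allowed.
  let F : Set (G × G) := (fun T : Mat2 => pairOf T 1) '' {T | (LinearMap.id (R := ℂ) T).det ≠ 0}
  have hF : IsPreconnected F := by
    refine (isPreconnected_det_ne_zero LinearMap.id).image _ fun T hT => ?_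
    have h2 : Continuous fun T : Mat2 => (T, (1 : Mat2)) := by fun_prop
    exact (ContinuousAt.comp (f := fun T : Mat2 => (T, (1 : Mat2)))
      (continuousAt_pairOf hT (by simp)) h2.continuousAt).continuousWithinAt
  -- As the conjugate of `d θ` is its inverse, `A = 1`, `W = d θ` is a solution; the path runs from
  -- `W = 1` in `F` to the nonscalar `W = diag(i, -i)` in `E`.
  let d : ℝ → SL(2, ℂ) := fun θ =>
    ⟨!![Complex.exp (θ * Complex.I), 0; 0, Complex.exp (-(θ * Complex.I))],
      by simp [Matrix.det_fin_two, ← Complex.exp_add]⟩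
  let P : Set (G × G) := Set.range fun θ : ℝ => pairOf (1 : SL(2, ℂ)) (d θ)
  have hd : ∀ θ, (1 : SL(2, ℂ)) * conjSL (d θ) = 1 * (d θ)⁻¹ * 1 := by
    intro θ
    rw [one_mul, one_mul, mul_one]
    apply Subtype.ext
    rw [coe_conjSL, Matrix.SpecialLinearGroup.coe_inv]
    ext i j; fin_cases i <;> fin_cases j <;>
      simp [d, conjMat_apply, Matrix.adjugate_fin_two, ← Complex.exp_conj]
  have hP : IsPreconnected P := by
    refine isPreconnected_range (continuous_iff_continuousAt.mpr fun θ => ?_)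
    have h2 : Continuous fun θ : ℝ => (((1 : SL(2, ℂ)) : Mat2), (d θ : Mat2)) :=
      continuous_const.prodMk (continuous_matrix_of (by fun_prop) (by fun_prop) (by fun_prop)
        (by fun_prop))
    exact ContinuousAt.comp (f := fun θ : ℝ => (((1 : SL(2, ℂ)) : Mat2), (d θ : Mat2)))
      (continuousAt_pairOf (by simp) (by simp)) h2.continuousAt
  have hPF : pairOf (1 : SL(2, ℂ)) (1 : SL(2, ℂ)) ∈ F := ⟨1, by simp, by simp⟩
  have hPF' : pairOf (1 : SL(2, ℂ)) (1 : SL(2, ℂ)) ∈ P := by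
    refine ⟨0, ?_⟩
    have : d 0 = 1 := by
      apply Subtype.ext
      ext i j; fin_cases i <;> fin_cases j <;> simp [d]
    simp only [this]
  have hPE : pairOf (1 : SL(2, ℂ)) (d (Real.pi / 2)) ∈ E := by
    refine pairOf_mem_image 1 1 _ (hd _) ?_
    rw [isNonscalar_iff]
    right; right
    have hI : Complex.exp (((Real.pi / 2 : ℝ) : ℂ) * Complex.I) = Complex.I := by
      push_cast; exact Complex.exp_pi_div_two_mul_I
    simp only [d, Complex.exp_neg, hI]
    simpa using fun h0 => Complex.I_ne_zero (self_eq_neg.mp h0)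
  have hPE' : pairOf (1 : SL(2, ℂ)) (d (Real.pi / 2)) ∈ P := ⟨_, rfl⟩
  have hFP := IsPreconnected.union _ hPF hPF' hF hP
  have hall := IsPreconnected.union _ hPE (Or.inr hPE') h1.isPreconnected hFP
  have hX : X₂ 1 = E ∪ (F ∪ P) := by
    refine Set.Subset.antisymm ?_ (Set.union_subset hsub (Set.union_subset ?_ ?_))
    · intro p hp
      obtain ⟨A, W, hAW, rfl⟩ := (mem_X₂_iff 1 p).mp hp
      by_cases hW : IsNonscalar W
      · exact Or.inl (pairOf_mem_image 1 A W hAW hW)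
      · refine Or.inr (Or.inl ⟨A, by simp, ?_⟩)
        obtain ⟨k, hk⟩ : ∃ k : ℂ, (W : Mat2) = k • (1 : Mat2) := by
          simpa [IsNonscalar] using hW
        have hk2 : k ^ 2 = 1 := by
          have := W.2
          rw [hk] at this
          simpa using this
        rcases sq_eq_sq_iff_eq_or_eq_neg.mp (hk2.trans (one_pow 2).symm) with rfl | rfl
        · simp [hk]
        -- `W` and `-W` define the same pair, because `B` matters only up to sign.
        · have hW1 : W = -1 := by apply Subtype.ext; simpa using hk
          have hneg : conjSL (A⁻¹ * -1) = -conjSL (A⁻¹ * 1) := by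
            apply Subtype.ext
            simp only [Matrix.SpecialLinearGroup.coe_neg, coe_conjSL]
            ext i j; simp [conjMat_apply]
          change pairOf A ((1 : SL(2, ℂ)) : Mat2) = _
          rw [hW1, pairOf_coe, pairOf_coe, hneg, mk_neg_SL]
    · rintro _ ⟨T, hT, rfl⟩
      obtain ⟨k, A, hk, rfl⟩ := exists_eq_smul_SL (M := T) hT
      change pairOf (k • (A : Mat2)) ((1 : SL(2, ℂ)) : Mat2) ∈ _
      rw [pairOf_smul A 1 hk, ← pairOf_coe, pairOf_mem_iff]
      simp
    · rintro _ ⟨θ, rfl⟩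
      exact (pairOf_mem_iff _ _ _).mpr (hd θ)
  rw [hX]
  exact ⟨h1.nonempty.mono Set.subset_union_left, hall⟩

theorem isConnected_X₂ (C : SL(2, ℂ)) : IsConnected (X₂ C) := by
  by_cases hC : C = 1
  · rw [hC]; exact isConnected_X₂_one
  · exact isConnected_X₂_of_ne_one hC (isConnected_productSet C)

end HypIsom

theorem mainTheorem5 (C : Matrix.SpecialLinearGroup (Fin 2) ℂ) :
    (HypIsom.X₂ C).Nonempty ∧ IsConnected (HypIsom.X₂ C) :=
  ⟨(HypIsom.isConnected_X₂ C).nonempty, HypIsom.isConnected_X₂ C⟩
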